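/- **Setting.** Let $S,A$ be finite sets, $A\neq\emptyset$, let $\mathcal C\subset[0,C_{\max}]$ be finite, let $H\ge 1$ be an episode length, $P_{\mathrm{init}}$ a distribution on $S$, and let $P$ be a prior distribution over MDPs $M$ with costs $C_M:S\times A\to\mathcal C$ and transition kernels $P_M(s'\mid s,a)$ (a probability measure on a measurable parameter space, on which $C_M$ and $P_M$ depend measurably). At time $t$ the next state is drawn from $P_M(\cdot\mid s_t,a_t)$, except that it is drawn from $P_{\mathrm{init}}$ if $H$ divides $t+1$. Fix a horizon $T\ge 0$ and $\lambda>0$. Let $\mathcal H$ be the finite set of histories $h_t=(s_0,a_0,c_0,\dots,s_t)$, $0\le t\le T$, and let $\Delta_A^{\mathcal H}$ be the set of policies $\pi(a\mid h)$, $h\in\mathcal H$. Let $P(M\mid h)$ be the posterior obtained from $P$ by successive Bayes updates along $h$ (an observation of predictive probability zero leaves the posterior unchanged), and let $P(c,s'\mid h,a)$ be the posterior predictive probability of the next cost and state. Put $\mathcal R(p)=\tfrac12\|p\|_2^2$, let $\mathcal B_{\mathcal R}(p,q)=\mathcal R(p)-\mathcal R(q)-\langle\nabla\mathcal R(q),p-q\rangle$,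 applied history by history to policies, and let $$C_\lambda(h,a;\pi)=\mathbb E_{M\mid h}C_M(s_t,a)+\lambda\mathcal R(\pi(\cdot\mid h)),\qquad V^\pi(h_t)=\mathbb E_{\pi;M\mid h_t}\Big[\sum_{t'=t}^{T}C_\lambda(h_{t'},a_{t'};\pi)\,\Big|\,h_t\Big].$$ Let $V^*(h)=\inf_\pi V^\pi(h)$. Let $\mathbf P^\pi$ be the $\mathcal H\times\mathcal H$ matrix whose entry in row $h$ and column $(h,a,c,s')$ is $\pi(a\mid h)P(c,s'\mid h,a)$ and whose other entries are $0$, and let $\mathcal P^\pi(\bar h\mid h)$ be the probability that $\bar h$ is observed after $h$ under $\pi$ (with $M$ drawn from $P(M\mid h)$). Uniform trust region policy optimization with step sizes $\alpha_k>0$ is any sequence of policies $\pi_0,\pi_1,\dots$ such that for all $k$ $$\pi_{k+1}\in\arg\min_{\pi\in\Delta_A^{\mathcal H}}\Big\{\langle\nabla V^{\pi_k},\pi-\pi_k\rangle+\tfrac1{\alpha_k}\mathcal P^{\pi_k}\mathcal B_{\mathcal R}(\pi,\pi_k)\Big\},$$ the minimum being attained in every component $h\in\mathcal H$ simultaneously.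 **Proposition.** There is a policy $\pi^*$ that is optimal at every history ($V^{\pi^*}\le V^{\pi}$ componentwise for all $\pi$), and $V^{\pi^*}=V^*$ for every such policy. Moreover: 1. Let $\{\pi_k\}$ be generated by uniform trust region policy optimization with step sizes $\alpha_k=\frac1{\lambda(k+2)}$, from an arbitrary $\pi_0$. Then $V^{\pi_k}\to V^*$, and for all $k\ge2$, componentwise, $$V^{\pi_k}-V^*\le\frac{\left(\lambda^2B+C_{\max}^2T^3\right)\log k}{\lambda k},\qquad B=2(T+1)^2 .$$ 2. (Quadratic growth.) For every policy $\pi_0$ and every optimal $\pi^*$, componentwise, $$\lambda\,\mathcal B_{\mathcal R}(\pi_0,\pi^*)\le(I-\mathbf P^{\pi_0})(V^{\pi_0}-V^{\pi^*}).$$ -/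

import Mathlib

open MeasureTheory Filter Topology

/-- A (nonempty) history `s₀, a₀, c₀, s₁, a₁, c₁, …, s_t`: either an initial state, or a history
followed by an action, the observed cost and the next state. -/
inductive History (S A C : Type*) where
  | start (s : S) : History S A C
  | snoc (h : History S A C) (a : A) (c : C) (s : S) : History S A C

namespace History

variable {S A C : Type*}

/-- The time `t` of the history `h_t`, i.e. the number of actions taken so far. -/
def length : History S A C → ℕ
  | start _ => 0
  | snoc h _ _ _ => h.length + 1

/-- The current state `s_t` of the history `h_t`. -/
def state : History S A C → S
  | start s => s
  | snoc _ _ _ s => s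

noncomputable instance : DecidableEq (History S A C) := Classical.decEq _

theorem finite_length_le [Finite S] [Finite A] [Finite C] (T : ℕ) :
    {h : History S A C | h.length ≤ T}.Finite := by
  induction T with
  | zero =>
    refine (Set.finite_range (start : S → History S A C)).subset ?_
    rintro (s | ⟨h, a, c, s⟩) hh
    · exact ⟨s, rfl⟩
    · simp [length] at hh
  | succ T ih =>
    refine ((Set.finite_range (start : S → History S A C)).union
      ((ih.prod (Set.finite_univ (α := A × C × S))).image
        (fun x => snoc x.1 x.2.1 x.2.2.1 x.2.2.2))).subset ?_
    rintro (s | ⟨h, a, c, s⟩) hh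
    · exact Or.inl ⟨s, rfl⟩
    · refine Or.inr ⟨(h, a, c, s), ⟨?_, Set.mem_univ _⟩, rfl⟩
      simpa [length] using hh

end History

/-- A Bayesian RL problem: a prior over MDPs `M_θ`, `θ ∈ Θ`, which share the finite state and
action spaces, the initial state distribution and the episode length, and differ in their costs
(with values in a finite subset of `[0, Cmax]`) and in their transition kernels. -/
structure BRLProblem (S A Θ : Type*) [Fintype S] [MeasurableSpace Θ] where
  /-- the episode length `H`: the state is redrawn from `init` after every `H` steps -/
  episode : ℕ
  episode_pos : 0 < episode
  /-- the initial state distribution -/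
  init : S → ℝ
  init_mem : init ∈ stdSimplex ℝ S
  /-- the finite set of possible costs -/
  costSet : Finset ℝ
  Cmax : ℝ
  costSet_bound : ∀ c ∈ costSet, 0 ≤ c ∧ c ≤ Cmax
  /-- the cost function `C_M(s, a)` of the MDP `M = M_θ` -/
  cost : Θ → S → A → costSet
  measurable_cost : ∀ s a, Measurable (fun θ => (cost θ s a : ℝ))
  /-- the transition probabilities `P_M(s' | s, a)` of the MDP `M = M_θ` -/
  trans : Θ → S → A → S → ℝ
  trans_mem : ∀ θ s a, trans θ s a ∈ stdSimplex ℝ S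
  measurable_trans : ∀ s a s', Measurable (fun θ => trans θ s a s')
  /-- the prior over MDPs -/
  prior : Measure Θ
  prior_prob : IsProbabilityMeasure prior

/-- The `L₂` regularizer `R(p) = ½ ‖p‖₂²`. -/
noncomputable def l2Reg {A : Type*} [Fintype A] (p : A → ℝ) : ℝ := (1 / 2) * ∑ a, p a ^ 2

/-- The Bregman distance `R(p) - R(q) - ⟨∇R(q), p - q⟩` of `R`. -/
noncomputable def bregman {A : Type*} [Fintype A] (R : (A → ℝ) → ℝ) (p q : A → ℝ) : ℝ :=
  R p - R q - fderiv ℝ R q (p - q)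

/-- The Bayes update of `ν` by the likelihood `l`; an observation of probability zero leaves `ν`
unchanged. -/
noncomputable def bayesUpdate {Θ : Type*} [MeasurableSpace Θ] (ν : Measure Θ) (l : Θ → ℝ) :
    Measure Θ :=
  if ∫ θ, l θ ∂ν = 0 then ν
  else ENNReal.ofReal (∫ θ, l θ ∂ν)⁻¹ • ν.withDensity (fun θ => ENNReal.ofReal (l θ))

namespace BRLProblem

variable {S A Θ : Type*} [Fintype S] [Fintype A] [MeasurableSpace Θ]

/-- Histories of the problem `M`, of any length. -/
abbrev Hist (M : BRLProblem S A Θ) : Type _ := History S A M.costSet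

/-- The finite space of histories `h_0, …, h_T`. -/
abbrev HistSpace (M : BRLProblem S A Θ) (T : ℕ) : Type _ := {h : M.Hist // h.length ≤ T}

noncomputable instance (M : BRLProblem S A Θ) (T : ℕ) : Fintype (M.HistSpace T) :=
  (History.finite_length_le T).fintype

/-- Tables `π(a | h)` of real numbers; policies are those whose rows are probability vectors. -/
abbrev Table (M : BRLProblem S A Θ) (T : ℕ) : Type _ := M.HistSpace T → A → ℝ

/-- The set of history dependent stochastic policies. -/
def policies (M : BRLProblem S A Θ) (T : ℕ) : Set (M.Table T) :=
  {π | ∀ h, π h ∈ stdSimplex ℝ A}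

/-- `P(s_{t+1} = s' | M_θ, s_t, a)`, including the reset after every `episode` steps. -/
noncomputable def nextProb (M : BRLProblem S A Θ) (θ : Θ) (h : M.Hist) (a : A) (s' : S) : ℝ :=
  if M.episode ∣ h.length + 1 then M.init s' else M.trans θ h.state a s'

/-- `P(c | M_θ, s_t, a) P(s' | M_θ, s_t, a)`. -/
noncomputable def stepLik (M : BRLProblem S A Θ) (θ : Θ) (h : M.Hist) (a : A) (c : M.costSet)
    (s' : S) : ℝ :=
  (if M.cost θ h.state a = c then 1 else 0) * M.nextProb θ h a s'

/-- The posterior over MDPs given the history, by successive Bayes updates. (The initial state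
carries no information, and the factors `π(a | h)` of the likelihood do not depend on `θ`.) -/
noncomputable def belief (M : BRLProblem S A Θ) : M.Hist → Measure Θ
  | .start _ => M.prior
  | .snoc h a c s => bayesUpdate (M.belief h) (fun θ => M.stepLik θ h a c s)

/-- The posterior predictive probability `P(c, s' | h, a)`. -/
noncomputable def obsProb (M : BRLProblem S A Θ) (h : M.Hist) (a : A) (c : M.costSet) (s' : S) :
    ℝ :=
  ∫ θ, M.stepLik θ h a c s' ∂(M.belief h)

/-- The posterior mean cost `E_{M | h} C_M(s_t, a)`. -/
noncomputable def meanCost (M : BRLProblem S A Θ) (h : M.Hist) (a : A) : ℝ :=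
  ∫ θ, (M.cost θ h.state a : ℝ) ∂(M.belief h)

/-- The regularized cost `C_λ(h, a; π) = E_{M | h} C_M(s_t, a) + λ R(π(· | h))`. -/
noncomputable def regCost (M : BRLProblem S A Θ) {T : ℕ} (lam : ℝ) (π : M.Table T)
    (h : M.HistSpace T) (a : A) : ℝ :=
  M.meanCost h.1 a + lam * l2Reg (π h)

/-- The probability that the history `g` is observed after the history `h`, when the policy `π`
is run in the MDP `M_θ` from `h` on. -/
noncomputable def histProb (M : BRLProblem S A Θ) {T : ℕ} (θ : Θ) (π : M.Table T) (h : M.Hist) :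
    (g : M.Hist) → g.length ≤ T → ℝ
  | .start s, _ => if .start s = h then 1 else 0
  | .snoc g a c s, hg =>
      if .snoc g a c s = h then 1
      else M.histProb θ π h g (Nat.le_of_succ_le hg) * π ⟨g, Nat.le_of_succ_le hg⟩ a *
        M.stepLik θ g a c s

/-- The probability that `g` is observed after `h` under the policy `π`, when the MDP is drawn
from the posterior given `h`. -/
noncomputable def visitProb (M : BRLProblem S A Θ) {T : ℕ} (π : M.Table T)
    (h g : M.HistSpace T) : ℝ :=
  ∫ θ, M.histProb θ π h.1 g.1 g.2 ∂(M.belief h.1)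

/-- The value `V^π(h_t) = E_{π; M | h_t} [∑_{t' = t}^T C_λ(h_{t'}, a_{t'}; π) | h_t]`. The sum over
`g` runs over all the values of `h_t, …, h_T`; histories that do not extend `h` have
probability zero. -/
noncomputable def value (M : BRLProblem S A Θ) {T : ℕ} (lam : ℝ) (π : M.Table T)
    (h : M.HistSpace T) : ℝ :=
  ∑ g, M.visitProb π h g * ∑ a, π g a * M.regCost lam π g a

/-- The optimal value `V*(h) = inf_π V^π(h)`. -/
noncomputable def optValue (M : BRLProblem S A Θ) {T : ℕ} (lam : ℝ) (h : M.HistSpace T) : ℝ :=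
  sInf ((fun π : M.Table T => M.value lam π h) '' M.policies T)

/-- `π*` is an optimal policy: it minimizes the value at every history. -/
def IsOptimal (M : BRLProblem S A Θ) {T : ℕ} (lam : ℝ) (πs : M.Table T) : Prop :=
  πs ∈ M.policies T ∧ ∀ π ∈ M.policies T, ∀ h, M.value lam πs h ≤ M.value lam π h

/-- The matrix of transition probabilities between histories under `π`; the entry at row `h`,
column `g` is `π(a | h) P(c, s' | h, a)` if `g` is `h` followed by `a, c, s'`, and `0` otherwise. -/
noncomputable def transMatrix (M : BRLProblem S A Θ) {T : ℕ} (π : M.Table T) :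
    Matrix (M.HistSpace T) (M.HistSpace T) ℝ :=
  Matrix.of fun h g =>
    match g.1 with
    | .start _ => 0
    | .snoc g' a c s => if g' = h.1 then π h a * M.obsProb h.1 a c s else 0

/-- The objective `⟨∇V^{π}, ρ - π⟩ + (1/α) 𝒫^{π} B_R(ρ, π)` of one policy update from `π`, as a
vector indexed by histories. The gradient is with respect to all the entries `π(a | h)`. -/
noncomputable def trpoObjective (M : BRLProblem S A Θ) {T : ℕ} (lam α : ℝ) (π ρ : M.Table T)
    (h : M.HistSpace T) : ℝ :=
  fderiv ℝ (fun σ : M.Table T => M.value lam σ h) π (ρ - π) +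
    (1 / α) * ∑ g, M.visitProb π h g * bregman l2Reg (ρ g) (π g)

/-- Uniform trust region policy optimization with step sizes `α k`: the iterates are policies, and
`π (k + 1)` minimizes the objective above, at every history, over all policies. -/
def IsUniformTRPO (M : BRLProblem S A Θ) {T : ℕ} (lam : ℝ) (α : ℕ → ℝ) (π : ℕ → M.Table T) :
    Prop :=
  (∀ k, π k ∈ M.policies T) ∧
  ∀ k, ∀ ρ ∈ M.policies T, ∀ h,
    M.trpoObjective lam (α k) (π k) (π (k + 1)) h ≤ M.trpoObjective lam (α k) (π k) ρ h

end BRLProblem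

/-! Averaging over the posterior turns the Bayesian problem into a Markov decision process on
finitely many histories: visit probabilities factor through the predictive kernel
(`visitProb_snoc`), so the visit matrix is the entrywise nonnegative inverse of `I - P^π`
(`visitMatrix_mul`). This gives a comparison principle, the performance difference formula and, by
differentiating the Bellman equation, the policy gradient.

For `v` fixed, the regularized Bellman operator is on each row a quadratic in the action
distribution with Hessian `λ`. At an optimal policy every row minimizes it, which is the quadratic
growth claim. A policy update also decouples into rows, each a quadratic with Hessian `m = 1/α`;
quadratic growth at its minimizer is the three-point inequality `bellman_update_le`.

Tested against `π_k`, that inequality makes the values decrease. Tested against an optimal policy,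
with `m_k = λ(k+2)`, the distance terms telescope because `m_k - λ = λ(k+1) = m_{k-1}`. Writing `δ_k
= V^{π_k} - V*`, the sum of the `δ_k` satisfies a Bellman-type inequality for `P^{π*}`, hence is
bounded independently of the number of terms; by monotonicity `δ_k` is at most a constant over `k`.
The factor `log k ≥ log 2` only absorbs constants. -/

set_option linter.unusedSectionVars false

/-! ### Bayes updates. -/

section BayesUpdate

variable {Θ : Type*} [MeasurableSpace Θ] {ν : Measure Θ} [IsProbabilityMeasure ν] {l : Θ → ℝ}

theorem integrable_of_nonneg_of_le_one (hm : Measurable l) (h0 : ∀ θ, 0 ≤ l θ)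
    (h1 : ∀ θ, l θ ≤ 1) : Integrable l ν :=
  Integrable.of_bound hm.aestronglyMeasurable 1
    (.of_forall fun θ => by rw [Real.norm_eq_abs, abs_of_nonneg (h0 θ)]; exact h1 θ)

theorem isProbabilityMeasure_bayesUpdate (hm : Measurable l) (h0 : ∀ θ, 0 ≤ l θ)
    (h1 : ∀ θ, l θ ≤ 1) : IsProbabilityMeasure (bayesUpdate ν l) := by
  unfold bayesUpdate
  split_ifs with h
  · infer_instance
  · constructor
    have hpos : 0 < ∫ θ, l θ ∂ν := lt_of_le_of_ne (integral_nonneg h0) (Ne.symm h)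
    rw [Measure.smul_apply, withDensity_apply _ MeasurableSet.univ, Measure.restrict_univ,
      ← ofReal_integral_eq_lintegral_ofReal (integrable_of_nonneg_of_le_one hm h0 h1)
        (.of_forall h0), smul_eq_mul, ← ENNReal.ofReal_mul (inv_nonneg.2 hpos.le),
      inv_mul_cancel₀ h, ENNReal.ofReal_one]

/-- Bayes' rule, in a form that also holds for an observation of probability zero. -/
theorem integral_mul_integral_bayesUpdate (hm : Measurable l) (h0 : ∀ θ, 0 ≤ l θ)
    (h1 : ∀ θ, l θ ≤ 1) (f : Θ → ℝ) :
    (∫ θ, l θ ∂ν) * ∫ θ, f θ ∂(bayesUpdate ν l) = ∫ θ, l θ * f θ ∂ν := by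
  unfold bayesUpdate
  split_ifs with h
  · rw [h, zero_mul]
    have hae := (integral_eq_zero_iff_of_nonneg h0
      (integrable_of_nonneg_of_le_one (ν := ν) hm h0 h1)).1 h
    rw [integral_congr_ae (g := fun _ => (0 : ℝ)) (by
      filter_upwards [hae] with θ hθ
      simp [hθ])]
    simp
  · have hpos : 0 < ∫ θ, l θ ∂ν := lt_of_le_of_ne (integral_nonneg h0) (Ne.symm h)
    rw [integral_smul_measure, ENNReal.toReal_ofReal (inv_nonneg.2 hpos.le), smul_eq_mul,
      mul_inv_cancel_left₀ h, integral_withDensity_eq_integral_toReal_smul hm.ennreal_ofReal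
        (.of_forall fun _ => ENNReal.ofReal_lt_top)]
    simp only [smul_eq_mul, ENNReal.toReal_ofReal (h0 _)]

end BayesUpdate

/-! ### Likelihoods, posteriors and predictive probabilities. -/

namespace BRLProblem

variable {S A Θ : Type*} [Fintype S] [Fintype A] [MeasurableSpace Θ] (M : BRLProblem S A Θ)

theorem nextProb_mem (θ : Θ) (h : M.Hist) (a : A) : M.nextProb θ h a ∈ stdSimplex ℝ S := by
  by_cases hd : M.episode ∣ h.length + 1
  · have : M.nextProb θ h a = M.init := by ext s; simp [nextProb, hd]
    exact this ▸ M.init_mem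
  · have : M.nextProb θ h a = M.trans θ h.state a := by ext s; simp [nextProb, hd]
    exact this ▸ M.trans_mem θ h.state a

theorem stepLik_nonneg (θ : Θ) (h : M.Hist) (a : A) (c : M.costSet) (s : S) :
    0 ≤ M.stepLik θ h a c s :=
  mul_nonneg (by split_ifs <;> norm_num) ((M.nextProb_mem θ h a).1 s)

theorem sum_stepLik (θ : Θ) (h : M.Hist) (a : A) :
    ∑ x : M.costSet × S, M.stepLik θ h a x.1 x.2 = 1 := by
  rw [Fintype.sum_prod_type]
  simp [stepLik, (M.nextProb_mem θ h a).2]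

theorem stepLik_le_one (θ : Θ) (h : M.Hist) (a : A) (c : M.costSet) (s : S) :
    M.stepLik θ h a c s ≤ 1 := by
  rw [← M.sum_stepLik θ h a]
  exact Finset.single_le_sum (f := fun x : M.costSet × S => M.stepLik θ h a x.1 x.2)
    (fun x _ => M.stepLik_nonneg θ h a x.1 x.2) (Finset.mem_univ (c, s))

theorem measurable_stepLik (h : M.Hist) (a : A) (c : M.costSet) (s : S) :
    Measurable (fun θ => M.stepLik θ h a c s) := by
  unfold stepLik
  refine Measurable.mul (Measurable.ite ?_ measurable_const measurable_const) ?_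
  · have : {θ | M.cost θ h.state a = c} = (fun θ => (M.cost θ h.state a : ℝ)) ⁻¹' {(c : ℝ)} := by
      ext θ; exact Subtype.ext_iff
    rw [this]
    exact M.measurable_cost _ _ (measurableSet_singleton _)
  · unfold nextProb
    split_ifs
    · exact measurable_const
    · exact M.measurable_trans _ _ _

instance isProbabilityMeasure_belief (h : M.Hist) : IsProbabilityMeasure (M.belief h) := by
  induction h with
  | start s => exact M.prior_prob
  | snoc h a c s ih =>
    exact isProbabilityMeasure_bayesUpdate (M.measurable_stepLik h a c s)
      (fun θ => M.stepLik_nonneg θ h a c s) (fun θ => M.stepLik_le_one θ h a c s)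

theorem obsProb_nonneg (h : M.Hist) (a : A) (c : M.costSet) (s : S) : 0 ≤ M.obsProb h a c s :=
  integral_nonneg fun θ => M.stepLik_nonneg θ h a c s

theorem sum_obsProb (h : M.Hist) (a : A) :
    ∑ x : M.costSet × S, M.obsProb h a x.1 x.2 = 1 := by
  unfold obsProb
  rw [← integral_finsetSum _ fun x _ => integrable_of_nonneg_of_le_one
    (M.measurable_stepLik h a x.1 x.2) (fun θ => M.stepLik_nonneg θ h a x.1 x.2)
    (fun θ => M.stepLik_le_one θ h a x.1 x.2)]
  simp [M.sum_stepLik]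

theorem meanCost_mem (h : M.Hist) (a : A) : 0 ≤ M.meanCost h a ∧ M.meanCost h a ≤ M.Cmax := by
  have hb θ := M.costSet_bound _ (M.cost θ h.state a).2
  refine ⟨integral_nonneg fun θ => (hb θ).1, ?_⟩
  have hint : Integrable (fun θ => (M.cost θ h.state a : ℝ)) (M.belief h) :=
    Integrable.of_bound (M.measurable_cost _ _).aestronglyMeasurable M.Cmax
      (.of_forall fun θ => by rw [Real.norm_eq_abs, abs_of_nonneg (hb θ).1]; exact (hb θ).2)
  calc M.meanCost h a ≤ ∫ _, M.Cmax ∂(M.belief h) :=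
        integral_mono hint (integrable_const _) fun θ => (hb θ).2
    _ = M.Cmax := by simp

/-! ### The Markov chain on histories and the inverse of `I - P^π`. -/

variable {T : ℕ}

theorem histProb_self (θ : Θ) (π : M.Table T) (h : M.Hist) (hh : h.length ≤ T) :
    M.histProb θ π h h hh = 1 := by
  cases h <;> simp [histProb]

/-- Tower property: weighting the posterior at `h` by the likelihood of the path to `g` gives the
posterior at `g`, up to the total weight. `f` varies in the induction, because Bayes' rule moves the
last likelihood factor into it. -/
theorem integral_histProb_mul (π : M.Table T) (h g : M.Hist) (hg : g.length ≤ T) (f : Θ → ℝ) :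
    ∫ θ, M.histProb θ π h g hg * f θ ∂(M.belief h) =
      (∫ θ, M.histProb θ π h g hg ∂(M.belief h)) * ∫ θ, f θ ∂(M.belief g) := by
  induction g generalizing f with
  | start s =>
    by_cases e : .start s = h
    · subst e; simp [histProb]
    · simp [histProb, e]
  | snoc g a c s ih =>
    by_cases e : .snoc g a c s = h
    · subst e; simp [histProb]
    · have hg' := Nat.le_of_succ_le hg
      have h1 : ∀ f : Θ → ℝ, ∫ θ, M.histProb θ π h (.snoc g a c s) hg * f θ ∂(M.belief h) =
          π ⟨g, hg'⟩ a * ((∫ θ, M.histProb θ π h g hg' ∂(M.belief h)) *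
            ∫ θ, M.stepLik θ g a c s * f θ ∂(M.belief g)) := fun f => by
        rw [← ih hg', ← integral_const_mul]
        congr 1 with θ
        simp only [histProb, e, if_false]
        ring
      -- The case `f = 1` computes the total weight of the longer path.
      have h2 := h1 fun _ => 1
      simp only [mul_one] at h2
      rw [h1, h2, mul_assoc, mul_assoc, belief,
        integral_mul_integral_bayesUpdate (M.measurable_stepLik g a c s)
          (fun θ => M.stepLik_nonneg θ g a c s) (fun θ => M.stepLik_le_one θ g a c s)]

theorem visitProb_start (π : M.Table T) (h : M.HistSpace T) (s : S) (hs) :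
    M.visitProb π h ⟨.start s, hs⟩ = if .start s = h.1 then 1 else 0 := by
  simp [visitProb, histProb]

/-- This is the reduction to a Markov chain: after averaging over `θ`, the last step depends on `g`
only, through the posterior predictive. -/
theorem visitProb_snoc (π : M.Table T) (h : M.HistSpace T) (g : M.Hist) (a : A) (c : M.costSet)
    (s : S) (hg : (History.snoc g a c s).length ≤ T) :
    M.visitProb π h ⟨.snoc g a c s, hg⟩ = if .snoc g a c s = h.1 then 1 else
      M.visitProb π h ⟨g, Nat.le_of_succ_le hg⟩ *
        (π ⟨g, Nat.le_of_succ_le hg⟩ a * M.obsProb g a c s) := by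
  unfold visitProb
  by_cases e : .snoc g a c s = h.1
  · simp [histProb, e]
  · simp only [histProb, e, if_false]
    rw [← mul_assoc, obsProb, mul_right_comm, ← M.integral_histProb_mul, ← integral_mul_const]
    congr 1 with θ
    ring

theorem visitProb_self (π : M.Table T) (h : M.HistSpace T) : M.visitProb π h h = 1 := by
  simp [visitProb, M.histProb_self]

theorem visitProb_eq_zero (π : M.Table T) (h : M.HistSpace T) (g : M.Hist) (hg : g.length ≤ T)
    (hlt : g.length < h.1.length) : M.visitProb π h ⟨g, hg⟩ = 0 := by
  induction g with
  | start s =>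
    rw [visitProb_start, if_neg]
    intro e
    rw [e] at hlt
    exact lt_irrefl _ hlt
  | snoc g a c s ih =>
    rw [visitProb_snoc, if_neg, ih _ (lt_trans (Nat.lt_succ_self _) hlt), zero_mul]
    intro e
    rw [e] at hlt
    exact lt_irrefl _ hlt

theorem visitProb_nonneg {π : M.Table T} (hπ : π ∈ M.policies T) (h : M.HistSpace T) (g : M.Hist)
    (hg : g.length ≤ T) : 0 ≤ M.visitProb π h ⟨g, hg⟩ := by
  induction g with
  | start s => rw [visitProb_start]; split_ifs <;> norm_num
  | snoc g a c s ih =>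
    rw [visitProb_snoc]
    split_ifs
    · norm_num
    · exact mul_nonneg (ih _) (mul_nonneg ((hπ _).1 a) (M.obsProb_nonneg g a c s))

theorem differentiable_visitProb (h : M.HistSpace T) (g : M.Hist) (hg : g.length ≤ T) :
    Differentiable ℝ (fun π : M.Table T => M.visitProb π h ⟨g, hg⟩) := by
  induction g with
  | start s => simp only [visitProb_start]; fun_prop
  | snoc g a c s ih =>
    simp only [visitProb_snoc]
    split_ifs
    · fun_prop
    · have := ih (Nat.le_of_succ_le hg)
      fun_prop

/-- `P(g | h, a)`, as a kernel on the space of histories. -/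
noncomputable def histKernel (h : M.HistSpace T) (a : A) (g : M.HistSpace T) : ℝ :=
  open Classical in
  match g.1 with
  | .start _ => 0
  | .snoc g' a' c s => if g' = h.1 ∧ a' = a then M.obsProb h.1 a c s else 0

theorem histKernel_nonneg (h : M.HistSpace T) (a : A) (g : M.HistSpace T) :
    0 ≤ M.histKernel h a g := by
  unfold histKernel
  split
  · exact le_rfl
  · split_ifs
    · exact M.obsProb_nonneg _ _ _ _
    · exact le_rfl

theorem length_of_histKernel_ne_zero {h : M.HistSpace T} {a : A} {g : M.HistSpace T}
    (hne : M.histKernel h a g ≠ 0) : g.1.length = h.1.length + 1 := by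
  obtain ⟨g, hg⟩ := g
  cases g with
  | start s => simp [histKernel] at hne
  | snoc g a' c s =>
    simp only [histKernel, ne_eq, ite_eq_right_iff, not_forall] at hne
    obtain ⟨⟨e, -⟩, -⟩ := hne
    simp [History.length, e]

/-- Histories of length `T` have no successor in the truncated space, so the kernel loses all its
mass there. -/
theorem sum_histKernel (h : M.HistSpace T) (a : A) :
    ∑ g, M.histKernel h a g = if h.1.length < T then 1 else 0 := by
  split_ifs with hT
  · rw [← M.sum_obsProb h.1 a]
    symm
    refine Fintype.sum_of_injective
      (fun x : M.costSet × S => (⟨.snoc h.1 a x.1 x.2, hT⟩ : M.HistSpace T)) ?_ _ _ ?_ ?_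
    · rintro ⟨c, s⟩ ⟨c', s'⟩ e
      simpa using congrArg Subtype.val e
    · rintro ⟨g, hg⟩ hr
      cases g with
      | start s => rfl
      | snoc g a' c s =>
        simp only [histKernel]
        rw [if_neg]
        rintro ⟨rfl, rfl⟩
        exact hr ⟨(c, s), rfl⟩
    · intro x
      simp [histKernel]
  · refine Finset.sum_eq_zero fun g _ => ?_
    by_contra hne
    have := M.length_of_histKernel_ne_zero hne
    have := g.2
    omega

theorem sum_histKernel_mul_length (h : M.HistSpace T) (a : A) (f : ℕ → ℝ) :
    ∑ g, M.histKernel h a g * f g.1.length = if h.1.length < T then f (h.1.length + 1) else 0 := by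
  have : ∀ g, M.histKernel h a g * f g.1.length = M.histKernel h a g * f (h.1.length + 1) := by
    intro g
    by_cases hne : M.histKernel h a g = 0
    · rw [hne, zero_mul, zero_mul]
    · rw [M.length_of_histKernel_ne_zero hne]
  rw [Finset.sum_congr rfl fun g _ => this g, ← Finset.sum_mul, sum_histKernel]
  split_ifs <;> simp

theorem transMatrix_apply (π : M.Table T) (h g : M.HistSpace T) :
    M.transMatrix π h g = ∑ a, π h a * M.histKernel h a g := by
  classical
  obtain ⟨g, hg⟩ := g
  cases g with
  | start s => simp [transMatrix, histKernel]
  | snoc g a c s =>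
    by_cases e : g = h.1
    · simp [transMatrix, histKernel, e]
    · simp [transMatrix, histKernel, e]

theorem transMatrix_mulVec (π : M.Table T) (v : M.HistSpace T → ℝ) (h : M.HistSpace T) :
    (M.transMatrix π).mulVec v h = ∑ a, π h a * ∑ g, M.histKernel h a g * v g := by
  simp only [Matrix.mulVec, dotProduct, transMatrix_apply, Finset.sum_mul, Finset.mul_sum]
  rw [Finset.sum_comm]
  simp only [mul_assoc]

theorem transMatrix_mulVec_mono {π : M.Table T} (hπ : π ∈ M.policies T) {v w : M.HistSpace T → ℝ}
    (hvw : v ≤ w) : (M.transMatrix π).mulVec v ≤ (M.transMatrix π).mulVec w := by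
  intro h
  simp only [transMatrix_mulVec]
  gcongr with a _ g _
  · exact (hπ h).1 a
  · exact M.histKernel_nonneg h a g
  · exact hvw g

theorem transMatrix_mulVec_length {π : M.Table T} (hπ : π ∈ M.policies T) (f : ℕ → ℝ)
    (h : M.HistSpace T) : (M.transMatrix π).mulVec (fun g => f g.1.length) h =
      if h.1.length < T then f (h.1.length + 1) else 0 := by
  simp only [transMatrix_mulVec, sum_histKernel_mul_length, ← Finset.sum_mul, (hπ h).2, one_mul]

/-- The matrix of the probabilities `𝒫^π(g | h)`. -/
noncomputable def visitMatrix (π : M.Table T) : Matrix (M.HistSpace T) (M.HistSpace T) ℝ :=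
  Matrix.of (M.visitProb π)

/-- Entrywise, this is the last-step recursion `𝒫 = I + 𝒫 P`. It holds for all tables, not only
policies, which the differentiation of the value needs. -/
theorem visitMatrix_mul (π : M.Table T) : M.visitMatrix π * (1 - M.transMatrix π) = 1 := by
  rw [mul_sub, mul_one, sub_eq_iff_eq_add]
  ext h ⟨g, hg⟩
  rw [Matrix.add_apply, Matrix.mul_apply, Matrix.one_apply]
  cases g with
  | start s => simp [visitMatrix, transMatrix, visitProb_start, Subtype.ext_iff, eq_comm]
  | snoc g a c s =>
    have hsum : ∑ j, M.visitMatrix π h j * M.transMatrix π j ⟨.snoc g a c s, hg⟩ =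
        M.visitProb π h ⟨g, Nat.le_of_succ_le hg⟩ *
        (π ⟨g, Nat.le_of_succ_le hg⟩ a * M.obsProb g a c s) := by
      rw [Finset.sum_eq_single (⟨g, Nat.le_of_succ_le hg⟩ : M.HistSpace T)]
      · simp [visitMatrix, transMatrix]
      · rintro j - hj
        have : g ≠ j.1 := fun e => hj (Subtype.ext e.symm)
        simp [transMatrix, this]
      · simp
    rw [hsum]
    simp only [visitMatrix, Matrix.of_apply, visitProb_snoc, Subtype.ext_iff]
    by_cases e : History.snoc g a c s = h.1
    -- On the diagonal the product term must vanish: `g` is shorter than `h`, so it cannot be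
    -- visited after `h`.
    · rw [M.visitProb_eq_zero π h g _ (by rw [← e]; exact Nat.lt_succ_self _)]
      simp [e]
    · rw [if_neg e, if_neg (Ne.symm e), zero_add]

theorem mul_visitMatrix (π : M.Table T) : (1 - M.transMatrix π) * M.visitMatrix π = 1 :=
  mul_eq_one_comm.1 (M.visitMatrix_mul π)

theorem eq_visitMatrix_mulVec {π : M.Table T} {u e : M.HistSpace T → ℝ}
    (hu : u = e + (M.transMatrix π).mulVec u) : u = (M.visitMatrix π).mulVec e := by
  have : e = (1 - M.transMatrix π).mulVec u := by
    rw [Matrix.sub_mulVec, Matrix.one_mulVec, eq_sub_iff_add_eq]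
    exact hu.symm
  rw [this, Matrix.mulVec_mulVec, visitMatrix_mul, Matrix.one_mulVec]

theorem visitMatrix_mulVec_eq (π : M.Table T) (e : M.HistSpace T → ℝ) :
    (M.visitMatrix π).mulVec e =
      e + (M.transMatrix π).mulVec ((M.visitMatrix π).mulVec e) := by
  have := congrArg (fun X => X.mulVec e) (M.mul_visitMatrix π)
  simp only [← Matrix.mulVec_mulVec, Matrix.sub_mulVec, Matrix.one_mulVec] at this
  exact sub_eq_iff_eq_add.1 this

theorem visitMatrix_mulVec_nonneg {π : M.Table T} (hπ : π ∈ M.policies T) {e : M.HistSpace T → ℝ}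
    (he : 0 ≤ e) : 0 ≤ (M.visitMatrix π).mulVec e := fun h =>
  Finset.sum_nonneg fun g _ => mul_nonneg (M.visitProb_nonneg hπ h g.1 g.2) (he g)

/-- Comparison principle for the operator `I - P^π`. -/
theorem le_of_sub_transMatrix_le {π : M.Table T} (hπ : π ∈ M.policies T)
    {u v e e' : M.HistSpace T → ℝ} (hu : u ≤ e + (M.transMatrix π).mulVec u)
    (hv : e' + (M.transMatrix π).mulVec v ≤ v) (he : e ≤ e') : u ≤ v := by
  have hw : v - u = (v - u - (M.transMatrix π).mulVec (v - u)) +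
      (M.transMatrix π).mulVec (v - u) := by abel
  rw [← sub_nonneg, M.eq_visitMatrix_mulVec hw]
  refine M.visitMatrix_mulVec_nonneg hπ fun h => ?_
  have h1 := hu h
  have h2 := hv h
  have h3 := he h
  rw [Matrix.mulVec_sub]
  simp only [Pi.add_apply, Pi.sub_apply, Pi.zero_apply] at *
  linarith

end BRLProblem

/-! ### Quadratic functions on convex sets. -/

section L2Reg

variable {A : Type*} [Fintype A]

theorem l2Reg_nonneg (p : A → ℝ) : 0 ≤ l2Reg p :=
  mul_nonneg (by norm_num) (Finset.sum_nonneg fun a _ => sq_nonneg (p a))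

theorem l2Reg_zero : l2Reg (0 : A → ℝ) = 0 := by simp [l2Reg]

theorem l2Reg_add_smul (q d : A → ℝ) (t : ℝ) :
    l2Reg (q + t • d) = l2Reg q + t * ∑ a, q a * d a + t ^ 2 * l2Reg d := by
  simp only [l2Reg, Finset.mul_sum, ← Finset.sum_add_distrib, Pi.add_apply, Pi.smul_apply,
    smul_eq_mul]
  exact Finset.sum_congr rfl fun a _ => by ring

theorem hasFDerivAt_l2Reg (q : A → ℝ) :
    HasFDerivAt l2Reg (∑ a, q a • ContinuousLinearMap.proj (R := ℝ) (φ := fun _ : A => ℝ) a) q := by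
  have h : ∀ a, HasFDerivAt (fun p : A → ℝ => p a ^ 2)
      ((2 * q a) • ContinuousLinearMap.proj (R := ℝ) (φ := fun _ : A => ℝ) a) q := fun a => by
    simpa using (hasFDerivAt_apply (𝕜 := ℝ) a q).pow 2
  refine ((HasFDerivAt.fun_sum fun a (_ : a ∈ Finset.univ) => h a).const_mul (1 / 2)).congr_fderiv ?_
  rw [Finset.smul_sum]
  exact Finset.sum_congr rfl fun a _ => by rw [smul_smul]; congr 1; ring

theorem bregman_l2Reg (p q : A → ℝ) : bregman l2Reg p q = l2Reg (p - q) := by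
  have h := l2Reg_add_smul q (p - q) 1
  rw [one_smul, add_sub_cancel] at h
  rw [bregman, (hasFDerivAt_l2Reg q).fderiv, h]
  simp
  ring

theorem l2Reg_le_half {p : A → ℝ} (hp : p ∈ stdSimplex ℝ A) : l2Reg p ≤ 1 / 2 := by
  have : ∑ a, p a ^ 2 ≤ ∑ a, p a := Finset.sum_le_sum fun a _ => by
    have h0 := hp.1 a
    have h1 : p a ≤ 1 := hp.2 ▸ Finset.single_le_sum (fun b _ => hp.1 b) (Finset.mem_univ a)
    nlinarith
  rw [hp.2] at this
  unfold l2Reg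
  linarith

theorem l2Reg_sub_le_one {p q : A → ℝ} (hp : p ∈ stdSimplex ℝ A) (hq : q ∈ stdSimplex ℝ A) :
    l2Reg (p - q) ≤ 1 := by
  have h : l2Reg (p - q) = l2Reg p + l2Reg q - ∑ a, p a * q a := by
    have := l2Reg_add_smul p q (-1)
    rw [neg_one_smul, ← sub_eq_add_neg] at this
    rw [this]
    ring
  have := Finset.sum_nonneg fun a (_ : a ∈ Finset.univ) => mul_nonneg (hp.1 a) (hq.1 a)
  linarith [l2Reg_le_half hp, l2Reg_le_half hq]

/-- Quadratic growth of a quadratic function with Hessian `m • 1` at a minimizer over a convex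
set. -/
theorem add_l2Reg_sub_le_of_isMinOn {s : Set (A → ℝ)} (hs : Convex ℝ s) {f : (A → ℝ) → ℝ}
    {c m : ℝ} {y : A → ℝ} (hf : ∀ p, f p = c + ∑ a, p a * y a + m * l2Reg p) {p q : A → ℝ}
    (hq : q ∈ s) (hp : p ∈ s) (hmin : ∀ p ∈ s, f q ≤ f p) : f q + m * l2Reg (p - q) ≤ f p := by
  have hexp : ∀ t : ℝ, f (q + t • (p - q)) = f q +
      t * (∑ a, (p - q) a * y a + m * ∑ a, q a * (p - q) a) + t ^ 2 * (m * l2Reg (p - q)) := by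
    intro t
    rw [hf, hf, l2Reg_add_smul]
    have : ∑ a, (q + t • (p - q)) a * y a = ∑ a, q a * y a + t * ∑ a, (p - q) a * y a := by
      simp only [Finset.mul_sum, ← Finset.sum_add_distrib, Pi.add_apply, Pi.smul_apply, smul_eq_mul]
      exact Finset.sum_congr rfl fun a _ => by ring
    rw [this]
    ring
  set L := ∑ a, (p - q) a * y a + m * ∑ a, q a * (p - q) a
  have h1 := hexp 1
  rw [one_smul, add_sub_cancel] at h1
  -- First-order optimality: divide `f q ≤ f (q + t • (p - q))` by `t` and let `t` decrease to `0`.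
  have hL : 0 ≤ L := by
    have ht : Tendsto (fun t : ℝ => L + t * (m * l2Reg (p - q))) (𝓝[>] 0)
        (𝓝 (L + 0 * (m * l2Reg (p - q)))) := by
      refine Tendsto.mono_left ?_ nhdsWithin_le_nhds
      exact Continuous.tendsto (by fun_prop) 0
    rw [zero_mul, add_zero] at ht
    refine ge_of_tendsto ht ?_
    filter_upwards [Ioc_mem_nhdsGT (show (0 : ℝ) < 1 by norm_num)] with t ht
    have := hmin _ (hs.add_smul_sub_mem hq hp ⟨ht.1.le, ht.2⟩)
    rw [hexp] at this
    refine nonneg_of_mul_nonneg_right (a := t) ?_ ht.1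
    linarith
  linarith

end L2Reg

/-! ### Bellman operator, optimal policies and policy gradient. -/

namespace BRLProblem

variable {S A Θ : Type*} [Fintype S] [Fintype A] [MeasurableSpace Θ] (M : BRLProblem S A Θ)
  {T : ℕ} (lam : ℝ)

/-- The one-step lookahead `E_{M | h} C_M(s, a) + E[v(h') | h, a]`. -/
noncomputable def lookahead (v : M.HistSpace T → ℝ) (h : M.HistSpace T) (a : A) : ℝ :=
  M.meanCost h.1 a + ∑ g, M.histKernel h a g * v g

/-- The regularized Bellman operator at `h`, for the action distribution `p`. -/
noncomputable def bellman (v : M.HistSpace T → ℝ) (h : M.HistSpace T) (p : A → ℝ) : ℝ :=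
  ∑ a, p a * M.lookahead v h a + lam * l2Reg p

/-- The expected one-step regularized cost of `π`. -/
noncomputable def stepCost (π : M.Table T) (h : M.HistSpace T) : ℝ :=
  ∑ a, π h a * M.regCost lam π h a

theorem value_eq (π : M.Table T) :
    M.value lam π = M.stepCost lam π + (M.transMatrix π).mulVec (M.value lam π) :=
  M.visitMatrix_mulVec_eq π _

theorem stepCost_of_mem {π : M.Table T} (hπ : π ∈ M.policies T) (h : M.HistSpace T) :
    M.stepCost lam π h = ∑ a, π h a * M.meanCost h.1 a + lam * l2Reg (π h) := by
  simp only [stepCost, regCost, mul_add, Finset.sum_add_distrib, ← Finset.sum_mul, (hπ h).2,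
    one_mul]

theorem stepCost_add_mulVec {π : M.Table T} (hπ : π ∈ M.policies T) (v : M.HistSpace T → ℝ)
    (h : M.HistSpace T) :
    M.stepCost lam π h + (M.transMatrix π).mulVec v h = M.bellman lam v h (π h) := by
  simp only [M.stepCost_of_mem lam hπ, transMatrix_mulVec, bellman, lookahead, mul_add,
    Finset.sum_add_distrib]
  ring

theorem value_eq_bellman {π : M.Table T} (hπ : π ∈ M.policies T) (h : M.HistSpace T) :
    M.value lam π h = M.bellman lam (M.value lam π) h (π h) := by
  rw [← M.stepCost_add_mulVec lam hπ]
  exact congrFun (M.value_eq lam π) h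

theorem value_le_of_bellman_le {π : M.Table T} (hπ : π ∈ M.policies T) {v : M.HistSpace T → ℝ}
    (hv : ∀ h, M.bellman lam v h (π h) ≤ v h) : M.value lam π ≤ v :=
  M.le_of_sub_transMatrix_le hπ (M.value_eq lam π).le
    (fun h => (M.stepCost_add_mulVec lam hπ v h).trans_le (hv h)) le_rfl

theorem le_value_of_le_bellman {π : M.Table T} (hπ : π ∈ M.policies T) {v : M.HistSpace T → ℝ}
    (hv : ∀ h, v h ≤ M.bellman lam v h (π h)) : v ≤ M.value lam π :=
  M.le_of_sub_transMatrix_le hπ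
    (fun h => (hv h).trans_eq (M.stepCost_add_mulVec lam hπ v h).symm) (M.value_eq lam π).ge le_rfl

theorem bellman_mono {v w : M.HistSpace T → ℝ} (hvw : v ≤ w) (h : M.HistSpace T) {p : A → ℝ}
    (hp : p ∈ stdSimplex ℝ A) : M.bellman lam v h p ≤ M.bellman lam w h p := by
  unfold bellman lookahead
  gcongr with a _ g _
  · exact hp.1 a
  · exact M.histKernel_nonneg h a g
  · exact hvw g

theorem bellman_eq_add_mulVec_sub {π : M.Table T} (hπ : π ∈ M.policies T)
    (v : M.HistSpace T → ℝ) (h : M.HistSpace T) :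
    M.bellman lam v h (π h) =
      M.value lam π h + (M.transMatrix π).mulVec (v - M.value lam π) h := by
  rw [M.value_eq_bellman lam hπ, ← M.stepCost_add_mulVec lam hπ, ← M.stepCost_add_mulVec lam hπ,
    Matrix.mulVec_sub, Pi.sub_apply]
  ring

/-- The performance difference formula. -/
theorem value_sub_value {π : M.Table T} (v : M.HistSpace T → ℝ) (hπ : π ∈ M.policies T) :
    v - M.value lam π = (M.visitMatrix π).mulVec fun g => v g - M.bellman lam v g (π g) := by
  refine M.eq_visitMatrix_mulVec (funext fun h => ?_)
  simp only [Pi.sub_apply, Pi.add_apply]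
  rw [M.bellman_eq_add_mulVec_sub lam hπ]
  ring

theorem update_mem_policies {π : M.Table T} (hπ : π ∈ M.policies T) (h : M.HistSpace T)
    {p : A → ℝ} (hp : p ∈ stdSimplex ℝ A) : Function.update π h p ∈ M.policies T := by
  intro g
  by_cases e : g = h
  · subst e; simpa using hp
  · simpa [e] using hπ g

/-- In the performance difference formula the rows left unchanged contribute zero, by their own
Bellman equation. -/
theorem value_sub_value_update {π : M.Table T} (hπ : π ∈ M.policies T) (h : M.HistSpace T)
    {p : A → ℝ} (hp : p ∈ stdSimplex ℝ A) (g : M.HistSpace T) :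
    M.value lam π g - M.value lam (Function.update π h p) g =
      M.visitProb (Function.update π h p) g h *
        (M.value lam π h - M.bellman lam (M.value lam π) h p) := by
  have := congrFun (M.value_sub_value lam (M.value lam π) (M.update_mem_policies hπ h hp)) g
  rw [Pi.sub_apply] at this
  rw [this]
  refine (Finset.sum_eq_single h (fun j _ hj => ?_) (by simp)).trans ?_
  · simp only [Function.update_of_ne hj, ← M.value_eq_bellman lam hπ j, sub_self, mul_zero]
  · simp [visitMatrix]

/-- A policy that cannot be improved by changing a single row is optimal. -/
theorem isOptimal_of_le_bellman {πs : M.Table T} (hπs : πs ∈ M.policies T)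
    (h : ∀ h, ∀ p ∈ stdSimplex ℝ A, M.value lam πs h ≤ M.bellman lam (M.value lam πs) h p) :
    M.IsOptimal lam πs :=
  ⟨hπs, fun _ hπ g => M.le_value_of_le_bellman lam hπ (fun h' => h h' _ (hπ h')) g⟩

theorem le_bellman_of_isOptimal {πs : M.Table T} (hs : M.IsOptimal lam πs) (h : M.HistSpace T)
    {p : A → ℝ} (hp : p ∈ stdSimplex ℝ A) :
    M.value lam πs h ≤ M.bellman lam (M.value lam πs) h p := by
  have h1 := M.value_sub_value_update lam hs.1 h hp h
  rw [visitProb_self, one_mul] at h1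
  linarith [hs.2 _ (M.update_mem_policies hs.1 h hp) h]

theorem differentiable_value (h : M.HistSpace T) :
    Differentiable ℝ (fun π : M.Table T => M.value lam π h) := by
  unfold value regCost l2Reg
  have := fun g : M.HistSpace T => M.differentiable_visitProb h g.1 g.2
  fun_prop

theorem isCompact_policies : IsCompact (M.policies T) := by
  have : M.policies T = Set.univ.pi fun _ => stdSimplex ℝ A := by ext; simp [policies]
  rw [this]
  exact isCompact_univ_pi fun _ => isCompact_stdSimplex ℝ A

/-- Minimize the sum of the values over the compact set of policies. Changing row `h` changes every
value by a nonnegative multiple of one and the same quantity, with factor `1` at `h` itself, so a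
minimizer of the sum admits no improving row change. -/
theorem exists_isOptimal [Nonempty A] : ∃ πs : M.Table T, M.IsOptimal lam πs := by
  classical
  have hne : (M.policies T).Nonempty :=
    ⟨fun _ => Pi.single (Classical.arbitrary A) 1, fun _ => single_mem_stdSimplex ℝ _⟩
  have hcont : Continuous fun π : M.Table T => ∑ h, M.value lam π h :=
    continuous_finsetSum _ fun h _ => (M.differentiable_value lam h).continuous
  obtain ⟨πs, hπs, hmin⟩ := M.isCompact_policies.exists_isMinOn hne hcont.continuousOn
  refine ⟨πs, M.isOptimal_of_le_bellman lam hπs fun h p hp => ?_⟩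
  have hmem := M.update_mem_policies hπs h hp
  have h1 : ∑ g, (M.value lam πs g - M.value lam (Function.update πs h p) g) ≤ 0 := by
    rw [Finset.sum_sub_distrib]
    exact sub_nonpos.2 (hmin hmem)
  simp only [M.value_sub_value_update lam hπs h hp, ← Finset.sum_mul] at h1
  have h2 : 0 < ∑ g, M.visitProb (Function.update πs h p) g h :=
    Finset.sum_pos' (fun g _ => M.visitProb_nonneg hmem g h.1 h.2)
      ⟨h, Finset.mem_univ h, by rw [visitProb_self]; norm_num⟩
  exact sub_nonpos.1 (nonpos_of_mul_nonpos_right h1 h2)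

theorem value_eq_optValue {πs : M.Table T} (hs : M.IsOptimal lam πs) :
    M.value lam πs = M.optValue lam := by
  ext h
  have hl : IsLeast ((fun π : M.Table T => M.value lam π h) '' M.policies T)
      (M.value lam πs h) := by
    refine ⟨⟨πs, hs.1, rfl⟩, ?_⟩
    rintro _ ⟨π, hπ, rfl⟩
    exact hs.2 π hπ h
  exact hl.csInf_eq.symm

/-- Row `πs h` minimizes over the simplex a quadratic with Hessian `lam`. -/
theorem bellman_add_le_of_isOptimal {πs : M.Table T} (hs : M.IsOptimal lam πs)
    (h : M.HistSpace T) {p : A → ℝ} (hp : p ∈ stdSimplex ℝ A) :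
    M.value lam πs h + lam * l2Reg (p - πs h) ≤ M.bellman lam (M.value lam πs) h p := by
  rw [M.value_eq_bellman lam hs.1 h]
  refine add_l2Reg_sub_le_of_isMinOn (convex_stdSimplex ℝ A) (c := 0)
    (fun p => by rw [zero_add]; rfl) (hs.1 h) hp fun p hp => ?_
  rw [← M.value_eq_bellman lam hs.1 h]
  exact M.le_bellman_of_isOptimal lam hs h hp

theorem quadratic_growth {π πs : M.Table T} (hπ : π ∈ M.policies T) (hs : M.IsOptimal lam πs)
    (h : M.HistSpace T) : lam * bregman l2Reg (π h) (πs h) ≤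
      ((1 - M.transMatrix π).mulVec (M.value lam π - M.value lam πs)) h := by
  have h1 := M.bellman_add_le_of_isOptimal lam hs h (hπ h)
  rw [M.bellman_eq_add_mulVec_sub lam hπ, ← neg_sub (M.value lam π), Matrix.mulVec_neg,
    Pi.neg_apply] at h1
  rw [bregman_l2Reg, Matrix.sub_mulVec, Matrix.one_mulVec, Pi.sub_apply, Pi.sub_apply]
  linarith

/-- The policy gradient theorem, for directions along which the rows keep their sums. -/
theorem fderiv_value {π : M.Table T} (hπ : π ∈ M.policies T) {d : M.Table T}
    (hd : ∀ h, ∑ a, d h a = 0) (h : M.HistSpace T) :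
    fderiv ℝ (fun σ : M.Table T => M.value lam σ h) π d =
      ∑ g, M.visitProb π h g *
        ∑ a, d g a * (M.lookahead (M.value lam π) g a + lam * π g a) := by
  set W : M.HistSpace T → ℝ := fun g => fderiv ℝ (fun σ : M.Table T => M.value lam σ g) π d with hW
  -- The derivative solves the linear equation obtained by differentiating the Bellman equation; the
  -- visit matrix inverts it.
  suffices hs : W = (fun g => ∑ a, d g a * (M.lookahead (M.value lam π) g a + lam * π g a)) +
      (M.transMatrix π).mulVec W from congrFun (M.eq_visitMatrix_mulVec hs) h
  funext g
  have hφ : ∀ g, HasDerivAt (fun t : ℝ => M.value lam (π + t • d) g) (W g) 0 := fun g =>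
    ((M.differentiable_value lam g) π).hasFDerivAt.hasLineDerivAt d
  have hc : ∀ a, HasDerivAt (fun t : ℝ => π g a + t * d g a) (d g a) 0 := fun a => by
    simpa using ((hasDerivAt_id (0 : ℝ)).mul_const (d g a)).const_add (π g a)
  have hr : HasDerivAt (fun t : ℝ => lam * ((1 / 2) * ∑ a, (π g a + t * d g a) ^ 2))
      (lam * ∑ a, π g a * d g a) 0 := by
    have := ((HasDerivAt.fun_sum fun a (_ : a ∈ Finset.univ) => (hc a).pow 2).const_mul
      (1 / 2)).const_mul lam
    refine this.congr_deriv ?_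
    rw [Finset.mul_sum]
    congr 1
    exact Finset.sum_congr rfl fun a _ => by simp; ring
  have hk : ∀ a, HasDerivAt (fun t : ℝ => ∑ j, M.histKernel g a j * M.value lam (π + t • d) j)
      (∑ j, M.histKernel g a j * W j) 0 := fun a =>
    HasDerivAt.fun_sum fun j _ => (hφ j).const_mul _
  have hsum := HasDerivAt.fun_sum fun a (_ : a ∈ Finset.univ) =>
    (hc a).mul ((hr.const_add (M.meanCost g.1 a)).add (hk a))
  -- `π + t • d` may leave the simplex, so the regularizer must stay inside the sum over actions.
  -- Its contribution through the weights `d g a` disappears at the end because these sum to zero.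
  have heq : (fun t : ℝ => M.value lam (π + t • d) g) = fun t => ∑ a, (π g a + t * d g a) *
      (M.meanCost g.1 a + lam * ((1 / 2) * ∑ a, (π g a + t * d g a) ^ 2) +
        ∑ j, M.histKernel g a j * M.value lam (π + t • d) j) := by
    funext t
    conv_lhs => rw [value_eq]
    simp only [Pi.add_apply, transMatrix_mulVec, stepCost, regCost, l2Reg, Pi.smul_apply,
      smul_eq_mul, mul_add, Finset.sum_add_distrib]
  have hg := hφ g
  rw [heq] at hg
  rw [hg.unique hsum, Pi.add_apply, transMatrix_mulVec]
  simp only [zero_mul, add_zero, zero_smul, lookahead, Pi.add_apply]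
  have hlin : lam * ∑ a, π g a * d g a = ∑ a, d g a * (lam * π g a) := by
    rw [Finset.mul_sum]
    exact Finset.sum_congr rfl fun a _ => by ring
  simp only [mul_add, Finset.sum_add_distrib, ← Finset.sum_mul, hd, (hπ g).2, zero_mul, one_mul,
    hlin]
  ring

end BRLProblem

/-! ### One policy update. -/

namespace BRLProblem

variable {S A Θ : Type*} [Fintype S] [Fintype A] [MeasurableSpace Θ] (M : BRLProblem S A Θ)
  {T : ℕ} (lam : ℝ)

/-- The part of the objective of a policy update that concerns a single history. -/
noncomputable def rowObjective (m : ℝ) (π : M.Table T) (g : M.HistSpace T) (p : A → ℝ) : ℝ :=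
  ∑ a, (p - π g) a * (M.lookahead (M.value lam π) g a + lam * π g a) + m * l2Reg (p - π g)

theorem trpoObjective_eq {π ρ : M.Table T} (hπ : π ∈ M.policies T) (hρ : ρ ∈ M.policies T)
    (m : ℝ) (h : M.HistSpace T) : M.trpoObjective lam (1 / m) π ρ h =
      ∑ g, M.visitProb π h g * M.rowObjective lam m π g (ρ g) := by
  have hd : ∀ g, ∑ a, (ρ - π) g a = 0 := fun g => by
    simp [Finset.sum_sub_distrib, (hπ g).2, (hρ g).2]
  simp only [trpoObjective, M.fderiv_value lam hπ hd, one_div_one_div, rowObjective, mul_add,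
    Finset.sum_add_distrib, Finset.mul_sum, bregman_l2Reg, Pi.sub_apply]
  congr 1
  exact Finset.sum_congr rfl fun g _ => by ring

/-- Compare `ρ` with its modification in row `h` only, at component `h`: the other rows cancel, and
`h` is visited from itself with probability one. -/
theorem rowObjective_le {m : ℝ} {π ρ : M.Table T} (hπ : π ∈ M.policies T)
    (hρ : ρ ∈ M.policies T) (hmin : ∀ σ ∈ M.policies T, ∀ h,
      M.trpoObjective lam (1 / m) π ρ h ≤ M.trpoObjective lam (1 / m) π σ h)
    (h : M.HistSpace T) {p : A → ℝ} (hp : p ∈ stdSimplex ℝ A) :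
    M.rowObjective lam m π h (ρ h) ≤ M.rowObjective lam m π h p := by
  have hmem := M.update_mem_policies hρ h hp
  have h1 := hmin _ hmem h
  rw [M.trpoObjective_eq lam hπ hρ, M.trpoObjective_eq lam hπ hmem, ← sub_nonneg,
    ← Finset.sum_sub_distrib, Finset.sum_eq_single h (fun j _ hj => by simp [hj]) (by simp),
    visitProb_self, one_mul, one_mul, Function.update_self, sub_nonneg] at h1
  exact h1

/-- Linearizing the Bellman quadratic at `π g` drops exactly `lam * l2Reg (p - π g)`, whence the
coefficient `m - lam`. -/
theorem rowObjective_eq (m : ℝ) {π : M.Table T} (hπ : π ∈ M.policies T) (g : M.HistSpace T)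
    (p : A → ℝ) : M.rowObjective lam m π g p =
      M.bellman lam (M.value lam π) g p - M.value lam π g + (m - lam) * l2Reg (p - π g) := by
  have h := l2Reg_add_smul (π g) (p - π g) 1
  rw [one_smul, add_sub_cancel] at h
  have h1 : ∑ a, (p - π g) a * (M.lookahead (M.value lam π) g a + lam * π g a) =
      ∑ a, p a * M.lookahead (M.value lam π) g a - ∑ a, π g a * M.lookahead (M.value lam π) g a +
        lam * ∑ a, π g a * (p - π g) a := by
    rw [Finset.mul_sum, ← Finset.sum_sub_distrib, ← Finset.sum_add_distrib]
    exact Finset.sum_congr rfl fun a _ => by simp only [Pi.sub_apply]; ring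
  rw [M.value_eq_bellman lam hπ g, rowObjective, h1, bellman, bellman, h]
  ring

/-- The three-point inequality for a policy update. -/
theorem bellman_update_le {m : ℝ} {π ρ : M.Table T} (hπ : π ∈ M.policies T)
    (hρ : ρ ∈ M.policies T) (hmin : ∀ σ ∈ M.policies T, ∀ h,
      M.trpoObjective lam (1 / m) π ρ h ≤ M.trpoObjective lam (1 / m) π σ h)
    (h : M.HistSpace T) {p : A → ℝ} (hp : p ∈ stdSimplex ℝ A) :
    M.bellman lam (M.value lam π) h (ρ h) + (m - lam) * l2Reg (ρ h - π h) +
        m * l2Reg (p - ρ h) ≤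
      M.bellman lam (M.value lam π) h p + (m - lam) * l2Reg (p - π h) := by
  have key := add_l2Reg_sub_le_of_isMinOn (convex_stdSimplex ℝ A)
    (f := M.rowObjective lam m π h) (m := m)
    (c := m * l2Reg (π h) - ∑ a, π h a * (M.lookahead (M.value lam π) h a + lam * π h a))
    (y := fun a => M.lookahead (M.value lam π) h a + lam * π h a - m * π h a)
    (fun p => by
      simp only [rowObjective, l2Reg, Finset.mul_sum, ← Finset.sum_sub_distrib,
        ← Finset.sum_add_distrib, Pi.sub_apply]
      exact Finset.sum_congr rfl fun a _ => by ring)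
    (hρ h) hp (fun p hp => M.rowObjective_le lam hπ hρ hmin h hp)
  rw [M.rowObjective_eq lam m hπ, M.rowObjective_eq lam m hπ] at key
  linarith

variable {lam}

theorem stepCost_mem (hlam : 0 ≤ lam) {π : M.Table T} (hπ : π ∈ M.policies T)
    (h : M.HistSpace T) : 0 ≤ M.stepCost lam π h ∧ M.stepCost lam π h ≤ M.Cmax + lam / 2 := by
  rw [M.stepCost_of_mem lam hπ]
  have h1 : ∑ a, π h a * M.meanCost h.1 a ≤ ∑ a, π h a * M.Cmax :=
    Finset.sum_le_sum fun a _ => mul_le_mul_of_nonneg_left (M.meanCost_mem _ a).2 ((hπ h).1 a)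
  rw [← Finset.sum_mul, (hπ h).2, one_mul] at h1
  have h2 := mul_le_mul_of_nonneg_left (l2Reg_le_half (hπ h)) hlam
  have h3 : 0 ≤ ∑ a, π h a * M.meanCost h.1 a :=
    Finset.sum_nonneg fun a _ => mul_nonneg ((hπ h).1 a) (M.meanCost_mem _ a).1
  exact ⟨add_nonneg h3 (mul_nonneg hlam (l2Reg_nonneg _)), by linarith⟩

theorem value_nonneg (hlam : 0 ≤ lam) {π : M.Table T} (hπ : π ∈ M.policies T) :
    0 ≤ M.value lam π :=
  M.visitMatrix_mulVec_nonneg hπ fun h => (M.stepCost_mem hlam hπ h).1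

theorem transMatrix_mulVec_comp_length {π : M.Table T} (hπ : π ∈ M.policies T) {f : ℝ → ℝ}
    (hf : f (T + 1) = 0) (h : M.HistSpace T) :
    (M.transMatrix π).mulVec (fun g => f g.1.length) h = f (h.1.length + 1) := by
  rw [M.transMatrix_mulVec_length hπ fun n => f n]
  split_ifs with hT
  · push_cast; rfl
  · rw [← hf, le_antisymm h.2 (not_lt.1 hT)]

theorem value_le (hlam : 0 ≤ lam) {π : M.Table T} (hπ : π ∈ M.policies T) :
    M.value lam π ≤ fun h => (M.Cmax + lam / 2) * ((T : ℝ) + 1 - h.1.length) := by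
  refine M.le_of_sub_transMatrix_le hπ (M.value_eq lam π).le (e' := fun _ => M.Cmax + lam / 2)
    (fun h => ?_) fun h => (M.stepCost_mem hlam hπ h).2
  rw [Pi.add_apply, M.transMatrix_mulVec_comp_length hπ
    (f := fun x => (M.Cmax + lam / 2) * ((T : ℝ) + 1 - x)) (by ring)]
  exact le_of_eq (by ring)

/-! ### Monotone decrease and the convergence rate. -/

section Rate

variable {M} {π : ℕ → M.Table T} {πs : M.Table T}

theorem IsUniformTRPO.bellman_le {m : ℕ → ℝ}
    (hπ : M.IsUniformTRPO lam (fun k => 1 / m k) π) (k : ℕ) (h : M.HistSpace T) {p : A → ℝ}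
    (hp : p ∈ stdSimplex ℝ A) :
    M.bellman lam (M.value lam (π k)) h (π (k + 1) h) +
        (m k - lam) * l2Reg (π (k + 1) h - π k h) + m k * l2Reg (p - π (k + 1) h) ≤
      M.bellman lam (M.value lam (π k)) h p + (m k - lam) * l2Reg (p - π k h) :=
  M.bellman_update_le lam (hπ.1 k) (hπ.1 (k + 1)) (hπ.2 k) h hp

theorem IsUniformTRPO.value_succ_le (hlam : 0 ≤ lam)
    (hπ : M.IsUniformTRPO lam (fun k : ℕ => 1 / (lam * ((k : ℝ) + 2))) π) (k : ℕ) :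
    M.value lam (π (k + 1)) ≤ M.value lam (π k) := by
  refine M.value_le_of_bellman_le lam (hπ.1 (k + 1)) fun h => ?_
  have h1 := hπ.bellman_le k h (hπ.1 k h)
  rw [sub_self, l2Reg_zero, mul_zero, add_zero, ← M.value_eq_bellman lam (hπ.1 k)] at h1
  have hm : 0 ≤ lam * ((k : ℝ) + 2) - lam := by nlinarith [(Nat.cast_nonneg k : (0 : ℝ) ≤ k)]
  have h2 := mul_nonneg hm (l2Reg_nonneg (π (k + 1) h - π k h))
  have h3 := mul_nonneg (show 0 ≤ lam * ((k : ℝ) + 2) by positivity)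
    (l2Reg_nonneg (π k h - π (k + 1) h))
  linarith

/-- Three-point inequality tested against `πs`. Since the values decrease, the new value is at most
the Bellman operator applied to the old value at the new policy. -/
theorem IsUniformTRPO.value_succ_sub_le (hlam : 0 ≤ lam)
    (hπ : M.IsUniformTRPO lam (fun k : ℕ => 1 / (lam * ((k : ℝ) + 2))) π)
    (hs : πs ∈ M.policies T) (k : ℕ) (h : M.HistSpace T) :
    M.value lam (π (k + 1)) h - M.value lam πs h ≤
      (M.transMatrix πs).mulVec (M.value lam (π k) - M.value lam πs) h +
        lam * (((k : ℝ) + 1) * l2Reg (πs h - π k h) -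
          ((k : ℝ) + 2) * l2Reg (πs h - π (k + 1) h)) := by
  have h1 := hπ.bellman_le k h (hs h)
  rw [M.bellman_eq_add_mulVec_sub lam hs] at h1
  have h2 := M.bellman_mono lam (hπ.value_succ_le hlam k) h (hπ.1 (k + 1) h)
  rw [← M.value_eq_bellman lam (hπ.1 (k + 1))] at h2
  have hm : 0 ≤ lam * ((k : ℝ) + 2) - lam := by nlinarith [(Nat.cast_nonneg k : (0 : ℝ) ≤ k)]
  have h3 := mul_nonneg hm (l2Reg_nonneg (π (k + 1) h - π k h))
  linarith

theorem IsUniformTRPO.sum_value_sub_le (hlam : 0 ≤ lam)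
    (hπ : M.IsUniformTRPO lam (fun k : ℕ => 1 / (lam * ((k : ℝ) + 2))) π)
    (hs : πs ∈ M.policies T) (K : ℕ) (h : M.HistSpace T) :
    ∑ k ∈ Finset.range K, (M.value lam (π (k + 1)) - M.value lam πs) h ≤
      (M.transMatrix πs).mulVec
          (∑ k ∈ Finset.range K, (M.value lam (π k) - M.value lam πs)) h +
        lam * (l2Reg (πs h - π 0 h) - ((K : ℝ) + 1) * l2Reg (πs h - π K h)) := by
  induction K with
  | zero => simp
  | succ K ih =>
    have := hπ.value_succ_sub_le hlam hs K h
    rw [Finset.sum_range_succ, Finset.sum_range_succ, Matrix.mulVec_add, Pi.add_apply,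
      Pi.sub_apply]
    push_cast
    linarith

theorem IsUniformTRPO.sum_value_sub_le_const (hlam : 0 ≤ lam)
    (hπ : M.IsUniformTRPO lam (fun k : ℕ => 1 / (lam * ((k : ℝ) + 2))) π)
    (hs : M.IsOptimal lam πs) (K : ℕ) (h : M.HistSpace T) :
    ∑ k ∈ Finset.range K, (M.value lam (π (k + 1)) - M.value lam πs) h ≤
      lam * ((T : ℝ) + 1) + (M.Cmax + lam / 2) * (((T : ℝ) + 1) * T / 2) := by
  set D := M.Cmax + lam / 2
  have hD0 : 0 ≤ D := (M.stepCost_mem hlam hs.1 h).1.trans (M.stepCost_mem hlam hs.1 h).2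
  set δ : ℕ → M.HistSpace T → ℝ := fun k => M.value lam (π k) - M.value lam πs with hδ
  have hδ0 : ∀ k, 0 ≤ δ k := fun k => sub_nonneg.2 fun g => hs.2 _ (hπ.1 k) g
  have hδw : δ 0 ≤ fun g => D * ((T : ℝ) + 1 - g.1.length) := fun g => by
    have h1 := M.value_le hlam (hπ.1 0) g
    have h2 := M.value_nonneg hlam hs.1 g
    exact (sub_le_self _ h2).trans h1
  -- Solution of `f x = lam + D * (T - x) + f (x + 1)` with `f (T + 1) = 0`. The source `lam` bounds
  -- the initial distance term, and `D * (T - x)` bounds the expectation of `δ 0` one step later.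
  set f : ℝ → ℝ := fun x => lam * ((T : ℝ) + 1 - x) + D * (((T : ℝ) + 1 - x) * (T - x) / 2)
  have key : (∑ k ∈ Finset.range K, δ (k + 1)) ≤ fun g => f g.1.length := by
    refine M.le_of_sub_transMatrix_le hs.1
      (e := (fun _ => lam) + (M.transMatrix πs).mulVec (δ 0))
      (e' := fun g => lam + D * (T - g.1.length)) (fun g => ?_) (fun g => ?_) (fun g => ?_)
    · have h1 := hπ.sum_value_sub_le hlam hs.1 K g
      -- Index shift that puts the same sum on both sides, as the comparison principle requires.
      have h2 : ∑ k ∈ Finset.range K, δ k ≤ δ 0 + ∑ k ∈ Finset.range K, δ (k + 1) := by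
        rw [add_comm, ← Finset.sum_range_succ' δ, Finset.sum_range_succ]
        exact le_add_of_nonneg_right (hδ0 K)
      have h3 := M.transMatrix_mulVec_mono hs.1 h2 g
      rw [Matrix.mulVec_add] at h3
      have h4 := mul_le_mul_of_nonneg_left (l2Reg_sub_le_one (hs.1 g) (hπ.1 0 g)) hlam
      have h5 := mul_nonneg hlam (mul_nonneg (show (0 : ℝ) ≤ (K : ℝ) + 1 by positivity)
        (l2Reg_nonneg (πs g - π K g)))
      simp only [Finset.sum_apply, Pi.add_apply, hδ] at h1 h3 ⊢
      linarith
    · rw [Pi.add_apply, M.transMatrix_mulVec_comp_length hs.1 (f := f) (by simp [f])]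
      exact le_of_eq (by simp only [f]; ring)
    · have h1 := M.transMatrix_mulVec_mono hs.1 hδw g
      rw [M.transMatrix_mulVec_comp_length hs.1 (f := fun x => D * ((T : ℝ) + 1 - x))
        (by ring)] at h1
      simp only [Pi.add_apply]
      linarith
  have h1 := key h
  rw [Finset.sum_apply] at h1
  refine h1.trans ?_
  have hn0 : (0 : ℝ) ≤ h.1.length := Nat.cast_nonneg _
  have hnT : (h.1.length : ℝ) ≤ T := Nat.cast_le.2 h.2
  simp only [f]
  gcongr
  · linarith
  · linarith
  · linarith

/-- By monotonicity the last gap is the smallest term of the bounded sum. -/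
theorem IsUniformTRPO.mul_value_sub_le (hlam : 0 ≤ lam)
    (hπ : M.IsUniformTRPO lam (fun k : ℕ => 1 / (lam * ((k : ℝ) + 2))) π)
    (hs : M.IsOptimal lam πs) (K : ℕ) (h : M.HistSpace T) :
    K * (M.value lam (π K) h - M.value lam πs h) ≤
      lam * ((T : ℝ) + 1) + (M.Cmax + lam / 2) * (((T : ℝ) + 1) * T / 2) := by
  refine le_trans ?_ (hπ.sum_value_sub_le_const hlam hs K h)
  have hanti : Antitone fun k => M.value lam (π k) :=
    antitone_nat_of_succ_le (hπ.value_succ_le hlam)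
  have := Finset.card_nsmul_le_sum (Finset.range K)
    (fun k => (M.value lam (π (k + 1)) - M.value lam πs) h)
    (M.value lam (π K) h - M.value lam πs h)
    (fun k hk => sub_le_sub_right (hanti (Nat.succ_le_of_lt (Finset.mem_range.1 hk)) h) _)
  simpa using this

end Rate

end BRLProblem

theorem const_le_mul_log (T : ℕ) {lam C L : ℝ} (hlam : 0 ≤ lam) (hC : 0 ≤ C) (hL : 0.69 ≤ L) :
    lam * (lam * ((T : ℝ) + 1) + (C + lam / 2) * (((T : ℝ) + 1) * T / 2)) ≤
      (lam ^ 2 * (2 * ((T : ℝ) + 1) ^ 2) + C ^ 2 * (T : ℝ) ^ 3) * L := by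
  have ht : (0 : ℝ) ≤ T := Nat.cast_nonneg T
  have h1 : ((T : ℝ) + 1) * T / 2 ≤ (T : ℝ) ^ 2 := by
    have : T ≤ T ^ 2 := Nat.le_self_pow two_ne_zero T
    have : (T : ℝ) ≤ (T : ℝ) ^ 2 := by exact_mod_cast this
    linarith
  have h2 : lam * C * (((T : ℝ) + 1) * T / 2) ≤ lam * C * (T : ℝ) ^ 2 :=
    mul_le_mul_of_nonneg_left h1 (mul_nonneg hlam hC)
  -- This splits the cross term `lam * C * T ^ 2`. The form is positive since `4 * 0.69 * 0.37 > 1`;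
  -- `0.69` is a lower bound for `log 2`, and `1.38` is its double.
  have h3 : 0 ≤ (T : ℝ) * (0.69 * (C * T) ^ 2 - lam * (C * T) + 0.37 * lam ^ 2) :=
    mul_nonneg ht (by nlinarith [sq_nonneg (1.38 * (C * T) - lam), sq_nonneg lam])
  have h4 : 0 ≤ lam ^ 2 * (1.38 * ((T : ℝ) + 1) ^ 2 - ((T : ℝ) + 1) - ((T : ℝ) + 1) * T / 4 -
      0.37 * T) := mul_nonneg (sq_nonneg _) (by nlinarith)
  have h5 : (lam ^ 2 * (2 * ((T : ℝ) + 1) ^ 2) + C ^ 2 * (T : ℝ) ^ 3) * 0.69 ≤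
      (lam ^ 2 * (2 * ((T : ℝ) + 1) ^ 2) + C ^ 2 * (T : ℝ) ^ 3) * L :=
    mul_le_mul_of_nonneg_left hL (by positivity)
  refine le_trans ?_ h5
  linarith

theorem mainTheorem4 {S A Θ : Type*} [Fintype S] [Fintype A] [Nonempty A] [MeasurableSpace Θ]
    (M : BRLProblem S A Θ) (T : ℕ) (lam : ℝ) (hlam : 0 < lam) :
    (∃ πs : M.Table T, M.IsOptimal lam πs) ∧
    (∀ πs : M.Table T, M.IsOptimal lam πs → M.value lam πs = M.optValue lam) ∧
    (∀ π : ℕ → M.Table T,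
      M.IsUniformTRPO lam (fun k : ℕ => 1 / (lam * ((k : ℝ) + 2))) π →
        (∀ h, Tendsto (fun k => M.value lam (π k) h) atTop (𝓝 (M.optValue lam h))) ∧
        ∀ k : ℕ, 2 ≤ k → ∀ h,
          M.value lam (π k) h - M.optValue lam h ≤
            (lam ^ 2 * (2 * ((T : ℝ) + 1) ^ 2) + M.Cmax ^ 2 * (T : ℝ) ^ 3) * Real.log k /
              (lam * k)) ∧
    (∀ π₀ ∈ M.policies T, ∀ πs : M.Table T, M.IsOptimal lam πs → ∀ h,
      lam * bregman l2Reg (π₀ h) (πs h) ≤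
        ((1 - M.transMatrix π₀).mulVec (M.value lam π₀ - M.value lam πs)) h) := by
  refine ⟨M.exists_isOptimal lam, fun πs hs => M.value_eq_optValue lam hs, fun π hπ => ?_,
    fun π₀ hπ₀ πs hs h => M.quadratic_growth lam hπ₀ hs h⟩
  obtain ⟨πs, hs⟩ := M.exists_isOptimal (T := T) lam
  rw [← M.value_eq_optValue lam hs]
  have hb := fun K h => hπ.mul_value_sub_le hlam.le hs K h
  constructor
  · intro h
    rw [← tendsto_sub_nhds_zero_iff]
    refine tendsto_of_tendsto_of_tendsto_of_le_of_le' tendsto_const_nhds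
      (tendsto_const_div_atTop_nhds_zero_nat
        (lam * ((T : ℝ) + 1) + (M.Cmax + lam / 2) * (((T : ℝ) + 1) * T / 2)))
      (.of_forall fun k => sub_nonneg.2 (hs.2 _ (hπ.1 k) h)) ?_
    filter_upwards [eventually_gt_atTop 0] with k hk
    rw [le_div_iff₀' (by exact_mod_cast hk)]
    exact hb k h
  · intro k hk h
    have hk0 : (0 : ℝ) < k := by exact_mod_cast lt_of_lt_of_le two_pos hk
    have hC : 0 ≤ M.Cmax :=
      (M.meanCost_mem h.1 (Classical.arbitrary A)).1.trans (M.meanCost_mem _ _).2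
    have hlog : (0.69 : ℝ) ≤ Real.log k := by
      have h1 : Real.log 2 ≤ Real.log k := Real.log_le_log two_pos (by exact_mod_cast hk)
      linarith [Real.log_two_gt_d9]
    rw [le_div_iff₀' (mul_pos hlam hk0), mul_assoc]
    exact (mul_le_mul_of_nonneg_left (hb k h) hlam.le).trans
      (const_le_mul_log T hlam.le hC hlog)
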